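/- Let $\mathbb{X}=(X_1,X_2,\ldots)$ be a sequence of real-valued random variables on a probability space $(\Omega,\mathcal{B},\mathbb{P})$. Suppose that its distribution $\mu$ on $\mathbb{R}^\infty=\mathbb{R}^{\mathbb{N}}$ is log-concave, that is, $$\mu\bigl(tA+(1-t)B\bigr)\ \ge\ \mu(A)^{t}\,\mu(B)^{1-t}$$ for all Borel sets $A,B\subset\mathbb{R}^\infty$ and all $0<t<1$, and that for every $n$ the distribution of $X^{(n)}=(X_1,\ldots,X_n)$ is absolutely continuous with respect to Lebesgue measure on $\mathbb{R}^n$. Let $f_n$ be any version of its density. Then the entropy $h(X^{(n)})=-\int_{\mathbb{R}^n} f_n(x)\log f_n(x)\,dx$ is well defined and finite for every $n$ (that is, $f_n\log f_n$ is integrable, where $0\log 0=0$). If, moreover, the limit $$h(\mathbb{X})=\lim_{n\to\infty}\frac{h(X^{(n)})}{n}$$ exists in $[-\infty,+\infty]$, then $$-\frac1n\log f_n\bigl(X^{(n)}\bigr)\ \longrightarrow\ h(\mathbb{X})\qquad\text{almost surely, as } n\to\infty .$$ -/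

import Mathlib

open MeasureTheory Filter Topology
open scoped Pointwise ENNReal

/-- A measure `μ` on a real vector space is log-concave if it satisfies the Brunn-Minkowski type
inequality `μ (t A + (1 - t) B) ≥ μ(A)^t μ(B)^(1-t)` for all measurable sets `A`, `B` and all
`0 < t < 1`.  (If `A` or `B` is empty, the right-hand side is `0`.)
The set `t A + (1 - t) B` need not be Borel, and in Lean `μ` of such a set is its outer measure.
On a Polish space such as `ℕ → ℝ` with its Borel σ-algebra, `t A + (1 - t) B` is an analytic set,
hence universally measurable, and its inner and outer measures coincide. -/
def IsLogConcaveMeasure {E : Type*} [AddCommGroup E] [Module ℝ E] [MeasurableSpace E]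
    (μ : Measure E) : Prop :=
  ∀ A B : Set E, MeasurableSet A → MeasurableSet B → ∀ t : ℝ, 0 < t → t < 1 →
    μ A ^ t * μ B ^ (1 - t) ≤ μ (t • A + (1 - t) • B)

/-- The path `ω ↦ (X₁(ω), X₂(ω), …)` of a real process, as a map into `ℝ^∞ = ℕ → ℝ`
(with indices starting at `0`). -/
def processPath {Ω : Type*} (X : ℕ → Ω → ℝ) (ω : Ω) : ℕ → ℝ := fun i => X i ω

/-- The projection `X^(n) = (X₁, …, Xₙ)` of a real process. -/
def initialVector {Ω : Type*} (X : ℕ → Ω → ℝ) (n : ℕ) (ω : Ω) : Fin n → ℝ := fun i => X i ω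

/-- `f` is (a version of) the density of the measure `ν` on `ℝⁿ` with respect to Lebesgue measure.
By Radon-Nikodym, a finite `ν` has a density exactly when it is absolutely continuous. -/
structure IsLebesgueDensity {n : ℕ} (ν : Measure (Fin n → ℝ)) (f : (Fin n → ℝ) → ℝ) : Prop where
  aemeasurable : AEMeasurable f volume
  nonneg : ∀ x, 0 ≤ f x
  eq_withDensity : ν = volume.withDensity (fun x => ENNReal.ofReal (f x))

/-- The (differential) entropy `h = - ∫ f(x) log f(x) dx` of a density `f` on `ℝⁿ`,
with `0 log 0 = 0`.  It is meaningful when `f log f` is Lebesgue integrable. -/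
noncomputable def densityEntropy {n : ℕ} (f : (Fin n → ℝ) → ℝ) : ℝ :=
  - ∫ x, f x * Real.log (f x)

/-! The information content `-log fₙ(X⁽ⁿ⁾)` of a log-concave density concentrates around its mean
`h(X⁽ⁿ⁾)`: a deviation of `nε`, with `0 < ε ≤ 1`, has probability at most `2 exp(-nε²/8)`. This is
summable in `n`, so by Borel-Cantelli the deviation divided by `n` tends to `0` almost surely;
adding `h(X⁽ⁿ⁾)/n → h` concludes, infinite `h` included.

The concentration rests on the log-concavity of `α ↦ αⁿ ∫ fₙ^α`
(`IsLogConcaveMeasure.scaled_lintegral_rpow_le`), which is Prékopa-Leindler applied to the functions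
`x ↦ fₙ(x/α)^α`. It forces all these integrals to be finite, so `log fₙ` has exponential moments and
the entropy is finite. With `α = 1 + s` it says that `cgf(s) + n log(1 + s)` is concave; its tangent
at `s = 0` bounds the cgf (`cgf_log_density_le`), and Chernoff's inequality gives both tails.

Log-concavity of `fₙ` itself comes from that of the law, by differentiation over shrinking balls. -/

/-! ### One-dimensional Brunn-Minkowski inequality. -/

/-- The translates `K + min L` and `max K + L` lie in `K + L` and meet in a single point. -/
theorem Real.volume_add_volume_le_of_isCompact {K L : Set ℝ} (hK : IsCompact K) (hL : IsCompact L)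
    (hK0 : K.Nonempty) (hL0 : L.Nonempty) : volume K + volume L ≤ volume (K + L) := by
  obtain ⟨a, haK, ha⟩ := hK.exists_isGreatest hK0
  obtain ⟨b, hbL, hb⟩ := hL.exists_isLeast hL0
  have h1 : volume ((fun x => x + b) '' K) = volume K := by
    rw [Set.image_add_right, measure_preimage_add_right]
  have h2 : volume ((fun x => a + x) '' L) = volume L := by
    rw [Set.image_add_left, measure_preimage_add]
  rw [← h1, ← h2, ← measure_union₀]
  · apply measure_mono
    rintro x (⟨y, hy, rfl⟩ | ⟨y, hy, rfl⟩)
    · exact Set.add_mem_add hy hbL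
    · exact Set.add_mem_add haK hy
  · exact (hL.image (by fun_prop)).measurableSet.nullMeasurableSet
  · refine measure_mono_null (t := {a + b}) ?_ (by simp)
    rintro x ⟨⟨y, hy, rfl⟩, ⟨z, hz, hzy⟩⟩
    have := ha hy
    have := hb hz
    simp only [Set.mem_singleton_iff] at *
    linarith

theorem Real.volume_add_volume_le {A B : Set ℝ} (hA : MeasurableSet A) (hB : MeasurableSet B)
    (hA0 : A.Nonempty) (hB0 : B.Nonempty) : volume A + volume B ≤ volume (A + B) := by
  obtain ⟨a, ha⟩ := hA0
  obtain ⟨b, hb⟩ := hB0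
  rw [hA.measure_eq_iSup_isCompact, hB.measure_eq_iSup_isCompact]
  simp only [iSup_and']
  refine ENNReal.biSup_add_biSup_le' (p := fun K => K ⊆ A ∧ IsCompact K)
    (q := fun K => K ⊆ B ∧ IsCompact K) ⟨∅, by simp⟩ ⟨∅, by simp⟩ ?_
  rintro K ⟨hKA, hK⟩ L ⟨hLB, hL⟩
  -- The approximating compacts may be empty; adjoining `a` and `b` makes them nonempty.
  calc volume K + volume L ≤ volume (insert a K) + volume (insert b L) :=
        add_le_add (measure_mono (Set.subset_insert _ _)) (measure_mono (Set.subset_insert _ _))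
    _ ≤ volume (insert a K + insert b L) :=
        volume_add_volume_le_of_isCompact (hK.insert a) (hL.insert b) ⟨a, by simp⟩ ⟨b, by simp⟩
    _ ≤ volume (A + B) := measure_mono
        (Set.add_subset_add (Set.insert_subset ha hKA) (Set.insert_subset hb hLB))

theorem Real.mul_volume_add_mul_volume_le {A B : Set ℝ} (hA : MeasurableSet A)
    (hB : MeasurableSet B) (hA0 : A.Nonempty) (hB0 : B.Nonempty) {t : ℝ} (ht0 : 0 < t)
    (ht1 : t < 1) :
    ENNReal.ofReal t * volume A + ENNReal.ofReal (1 - t) * volume B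
      ≤ volume (t • A + (1 - t) • B) := by
  have h := Real.volume_add_volume_le (hA.const_smul₀ t) (hB.const_smul₀ (1 - t))
    (hA0.smul_set) (hB0.smul_set)
  simpa [Measure.addHaar_smul, abs_of_pos ht0, abs_of_pos (sub_pos.2 ht1)] using h

/-! ### Prékopa-Leindler inequality, first on the line, then in all dimensions. -/

/-- The Prékopa-Leindler inequality for a measure on a real vector space. -/
def PrekopaLeindler {E : Type*} [AddCommGroup E] [Module ℝ E] [MeasurableSpace E]
    (μ : Measure E) : Prop :=
  ∀ t : ℝ, 0 < t → t < 1 → ∀ f g h : E → ℝ≥0∞, Measurable f → Measurable g → Measurable h →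
    (∀ x y, f x ^ t * g y ^ (1 - t) ≤ h (t • x + (1 - t) • y)) →
    (∫⁻ x, f x ∂μ) ^ t * (∫⁻ x, g x ∂μ) ^ (1 - t) ≤ ∫⁻ x, h x ∂μ

theorem lintegral_eq_lintegral_Ioo_of_le_one {E : Type*} [MeasurableSpace E] (μ : Measure E)
    {f : E → ℝ≥0∞} (hf : Measurable f) (hf1 : ∀ x, f x ≤ 1) :
    ∫⁻ x, f x ∂μ = ∫⁻ s in Set.Ioo (0 : ℝ) 1, μ {x | ENNReal.ofReal s < f x} := by
  have hfin : ∀ x, f x ≠ ⊤ := fun x => ((hf1 x).trans_lt ENNReal.one_lt_top).ne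
  have h1 : ∫⁻ x, f x ∂μ = ∫⁻ x, ENNReal.ofReal (f x).toReal ∂μ := by
    simp [ENNReal.ofReal_toReal, hfin]
  rw [h1, lintegral_eq_lintegral_meas_lt μ (Eventually.of_forall fun x => ENNReal.toReal_nonneg)
    (hf.ennreal_toReal.aemeasurable), ← Set.Ioo_union_Ici_eq_Ioi (zero_lt_one' ℝ),
    lintegral_union measurableSet_Ici (Set.disjoint_left.2 fun x hx hx' => not_lt.2 hx' hx.2)]
  have h2 : ∫⁻ s in Set.Ici (1 : ℝ), μ {x | s < (f x).toReal} = 0 := by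
    rw [setLIntegral_congr_fun (g := 0) measurableSet_Ici]
    · simp
    · intro s hs
      have : {x | s < (f x).toReal} = ∅ := by
        ext x
        simp only [Set.mem_ofPred_eq, Set.mem_empty_iff_false, iff_false, not_lt]
        exact (ENNReal.toReal_mono ENNReal.one_ne_top (hf1 x)).trans (by simpa using hs)
      simp [this]
  rw [h2, add_zero]
  refine setLIntegral_congr_fun measurableSet_Ioo fun s hs => ?_
  simp only [ENNReal.ofReal_lt_iff_lt_toReal hs.1.le (hfin _)]

theorem ENNReal.rpow_mul_rpow_le_add {t : ℝ} (ht0 : 0 < t) (ht1 : t < 1) (a b : ℝ≥0∞) :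
    a ^ t * b ^ (1 - t) ≤ ENNReal.ofReal t * a + ENNReal.ofReal (1 - t) * b := by
  have ht1' : 0 < 1 - t := sub_pos.2 ht1
  rcases eq_or_ne a ⊤ with rfl | ha
  · simp [ENNReal.mul_top, ht0]
  rcases eq_or_ne b ⊤ with rfl | hb
  · simp [ENNReal.mul_top, ht1]
  have h := Real.geom_mean_le_arith_mean2_weighted ht0.le ht1'.le
    (ENNReal.toReal_nonneg (a := a)) (ENNReal.toReal_nonneg (a := b)) (by ring)
  have h' := ENNReal.ofReal_le_ofReal h
  rwa [ENNReal.ofReal_mul (by positivity), ENNReal.ofReal_add (by positivity) (by positivity),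
    ENNReal.ofReal_mul ht0.le, ENNReal.ofReal_mul ht1'.le,
    ← ENNReal.ofReal_rpow_of_nonneg ENNReal.toReal_nonneg ht0.le,
    ← ENNReal.ofReal_rpow_of_nonneg ENNReal.toReal_nonneg ht1'.le,
    ENNReal.ofReal_toReal ha, ENNReal.ofReal_toReal hb] at h'

/-- Equal suprema make the superlevel sets of `f` and `g` nonempty for exactly the same levels, so
Brunn-Minkowski applies level by level. Integrating over levels gives the arithmetic-mean bound,
which is stronger by AM-GM. -/
theorem Real.prekopaLeindler_of_iSup_eq_one {t : ℝ} (ht0 : 0 < t) (ht1 : t < 1)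
    {f g h : ℝ → ℝ≥0∞} (hf : Measurable f) (hg : Measurable g) (hh : Measurable h)
    (hfs : ⨆ x, f x = 1) (hgs : ⨆ x, g x = 1)
    (hfgh : ∀ x y, f x ^ t * g y ^ (1 - t) ≤ h (t • x + (1 - t) • y)) :
    (∫⁻ x, f x) ^ t * (∫⁻ x, g x) ^ (1 - t) ≤ ∫⁻ x, h x := by
  have hf1 : ∀ x, f x ≤ 1 := fun x => hfs ▸ le_iSup f x
  have hg1 : ∀ x, g x ≤ 1 := fun x => hgs ▸ le_iSup g x
  refine (ENNReal.rpow_mul_rpow_le_add ht0 ht1 _ _).trans ?_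
  -- Only levels below `1` matter, so `h` may be truncated there.
  refine le_trans ?_ (lintegral_mono (f := fun x => min (h x) 1) fun x => min_le_left _ _)
  have anti : ∀ u : ℝ → ℝ≥0∞, Measurable fun s : ℝ => volume {x | ENNReal.ofReal s < u x} :=
    fun u => Antitone.measurable fun s s' hs => measure_mono fun x hx =>
      (ENNReal.ofReal_le_ofReal hs).trans_lt hx
  rw [lintegral_eq_lintegral_Ioo_of_le_one _ hf hf1, lintegral_eq_lintegral_Ioo_of_le_one _ hg hg1,
    lintegral_eq_lintegral_Ioo_of_le_one _ (hh.min measurable_const) (fun x => min_le_right _ _),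
    ← lintegral_const_mul _ (anti f), ← lintegral_const_mul _ (anti g),
    ← lintegral_add_left ((anti f).const_mul _)]
  refine setLIntegral_mono' measurableSet_Ioo fun s hs => ?_
  have hs1 : ENNReal.ofReal s < 1 := by simpa using hs.2
  have hs0 : 0 < ENNReal.ofReal s := by simpa using hs.1
  have hfne : {x | ENNReal.ofReal s < f x}.Nonempty := by
    obtain ⟨x, hx⟩ := lt_iSup_iff.1 (hfs.symm ▸ hs1)
    exact ⟨x, hx⟩
  have hgne : {x | ENNReal.ofReal s < g x}.Nonempty := by
    obtain ⟨x, hx⟩ := lt_iSup_iff.1 (hgs.symm ▸ hs1)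
    exact ⟨x, hx⟩
  refine (Real.mul_volume_add_mul_volume_le (measurableSet_lt measurable_const hf)
    (measurableSet_lt measurable_const hg) hfne hgne ht0 ht1).trans (measure_mono ?_)
  rintro _ ⟨_, ⟨x, hx, rfl⟩, _, ⟨y, hy, rfl⟩, rfl⟩
  refine lt_min (lt_of_lt_of_le ?_ (hfgh x y)) hs1
  calc ENNReal.ofReal s = ENNReal.ofReal s ^ t * ENNReal.ofReal s ^ (1 - t) := by
        rw [← ENNReal.rpow_add _ _ hs0.ne' ENNReal.ofReal_ne_top]; simp
    _ < f x ^ t * g y ^ (1 - t) := ENNReal.mul_lt_mul (ENNReal.rpow_lt_rpow hx ht0)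
        (ENNReal.rpow_lt_rpow hy (sub_pos.2 ht1))

theorem Real.prekopaLeindler_of_bounded {t : ℝ} (ht0 : 0 < t) (ht1 : t < 1)
    {f g h : ℝ → ℝ≥0∞} (hf : Measurable f) (hg : Measurable g) (hh : Measurable h)
    (hfs : ⨆ x, f x ≠ ⊤) (hgs : ⨆ x, g x ≠ ⊤)
    (hfgh : ∀ x y, f x ^ t * g y ^ (1 - t) ≤ h (t • x + (1 - t) • y)) :
    (∫⁻ x, f x) ^ t * (∫⁻ x, g x) ^ (1 - t) ≤ ∫⁻ x, h x := by
  have ht1' : 0 < 1 - t := sub_pos.2 ht1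
  set M := ⨆ x, f x
  set N := ⨆ x, g x
  rcases eq_or_ne M 0 with hM | hM
  · have : ∀ x, f x = 0 := ENNReal.iSup_eq_zero.1 hM
    simp [this, ht0]
  rcases eq_or_ne N 0 with hN | hN
  · have : ∀ x, g x = 0 := ENNReal.iSup_eq_zero.1 hN
    simp [this, ht1]
  have hC0 : M ^ t * N ^ (1 - t) ≠ 0 := by
    simp [hM, hN, hfs, hgs, ENNReal.rpow_eq_zero_iff]
  have hCtop : M ^ t * N ^ (1 - t) ≠ ⊤ :=
    ENNReal.mul_ne_top (ENNReal.rpow_ne_top_of_nonneg ht0.le hfs)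
      (ENNReal.rpow_ne_top_of_nonneg ht1'.le hgs)
  have key := Real.prekopaLeindler_of_iSup_eq_one ht0 ht1 (hf.const_mul M⁻¹) (hg.const_mul N⁻¹)
    (hh.const_mul (M ^ t * N ^ (1 - t))⁻¹)
    (by rw [← ENNReal.mul_iSup, ENNReal.inv_mul_cancel hM hfs])
    (by rw [← ENNReal.mul_iSup, ENNReal.inv_mul_cancel hN hgs])
    (fun x y => by
      rw [ENNReal.mul_rpow_of_nonneg _ _ ht0.le, ENNReal.mul_rpow_of_nonneg _ _ ht1'.le,
        mul_mul_mul_comm, ENNReal.inv_rpow, ENNReal.inv_rpow,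
        ENNReal.mul_inv (Or.inr (ENNReal.rpow_ne_top_of_nonneg ht1'.le hgs))
          (Or.inl (ENNReal.rpow_ne_top_of_nonneg ht0.le hfs))]
      gcongr
      exact hfgh x y)
  rw [lintegral_const_mul _ hf, lintegral_const_mul _ hg, lintegral_const_mul _ hh,
    ENNReal.mul_rpow_of_nonneg _ _ ht0.le, ENNReal.mul_rpow_of_nonneg _ _ ht1'.le,
    mul_mul_mul_comm, ENNReal.inv_rpow, ENNReal.inv_rpow,
    ← ENNReal.mul_inv (Or.inr (ENNReal.rpow_ne_top_of_nonneg ht1'.le hgs))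
      (Or.inl (ENNReal.rpow_ne_top_of_nonneg ht0.le hfs))] at key
  exact (ENNReal.mul_le_mul_iff_right (ENNReal.inv_ne_zero.2 hCtop)
    (ENNReal.inv_ne_top.2 hC0)).1 key

theorem tendsto_lintegral_min_natCast {E : Type*} [MeasurableSpace E] (μ : Measure E)
    {f : E → ℝ≥0∞} (hf : Measurable f) :
    Tendsto (fun k : ℕ => ∫⁻ x, min (f x) k ∂μ) atTop (𝓝 (∫⁻ x, f x ∂μ)) := by
  refine lintegral_tendsto_of_tendsto_of_monotone
    (fun k => (hf.min measurable_const).aemeasurable)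
    (Eventually.of_forall fun x i j hij => min_le_min le_rfl (by exact_mod_cast hij))
    (Eventually.of_forall fun x => ?_)
  simpa using (tendsto_const_nhds (x := f x)).min ENNReal.tendsto_nat_nhds_top

theorem Real.prekopaLeindler_volume : PrekopaLeindler (volume : Measure ℝ) := by
  intro t ht0 ht1 f g h hf hg hh hfgh
  have ht1' : 0 < 1 - t := sub_pos.2 ht1
  rcases eq_or_ne (∫⁻ x, f x) 0 with hf0 | hf0
  · simp [hf0, ht0]
  rcases eq_or_ne (∫⁻ x, g x) 0 with hg0 | hg0
  · simp [hg0, ht1]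
  refine le_of_tendsto (ENNReal.Tendsto.mul
    ((ENNReal.continuous_rpow_const.tendsto _).comp (tendsto_lintegral_min_natCast volume hf))
    (Or.inl ?_)
    ((ENNReal.continuous_rpow_const.tendsto _).comp (tendsto_lintegral_min_natCast volume hg))
    (Or.inl ?_)) (Eventually.of_forall fun k => ?_)
  · simp [ENNReal.rpow_eq_zero_iff, hf0, ht0.not_gt]
  · simp [ENNReal.rpow_eq_zero_iff, hg0, ht1.not_gt]
  · refine Real.prekopaLeindler_of_bounded ht0 ht1 (hf.min measurable_const)
      (hg.min measurable_const) hh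
      ((iSup_le fun x => min_le_right _ _).trans_lt (ENNReal.natCast_lt_top k)).ne
      ((iSup_le fun x => min_le_right _ _).trans_lt (ENNReal.natCast_lt_top k)).ne
      fun x y => le_trans ?_ (hfgh x y)
    gcongr
    · exact min_le_left _ _
    · exact min_le_left _ _

/-- By Fubini: the inequality for `ν` on fibres is the hypothesis needed to apply the one for `μ` to
the partial integrals. -/
theorem PrekopaLeindler.prod {E F : Type*} [AddCommGroup E] [Module ℝ E] [MeasurableSpace E]
    [AddCommGroup F] [Module ℝ F] [MeasurableSpace F] {μ : Measure E} {ν : Measure F}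
    [SFinite μ] [SFinite ν] (hμ : PrekopaLeindler μ) (hν : PrekopaLeindler ν) :
    PrekopaLeindler (μ.prod ν) := by
  intro t ht0 ht1 f g h hf hg hh hfgh
  rw [lintegral_prod _ hf.aemeasurable, lintegral_prod _ hg.aemeasurable,
    lintegral_prod _ hh.aemeasurable]
  refine hμ t ht0 ht1 _ _ _ hf.lintegral_prod_right' hg.lintegral_prod_right'
    hh.lintegral_prod_right' fun x y => ?_
  exact hν t ht0 ht1 _ _ _ (hf.comp measurable_prodMk_left) (hg.comp measurable_prodMk_left)
    (hh.comp measurable_prodMk_left) fun x' y' => hfgh (x, x') (y, y')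

theorem PrekopaLeindler.of_measurePreserving {E F : Type*} [AddCommGroup E] [Module ℝ E]
    [MeasurableSpace E] [AddCommGroup F] [Module ℝ F] [MeasurableSpace F] {μ : Measure E}
    {ν : Measure F} (hμ : PrekopaLeindler μ) (e : E →ₗ[ℝ] F) (he : MeasurePreserving e μ ν) :
    PrekopaLeindler ν := by
  intro t ht0 ht1 f g h hf hg hh hfgh
  rw [← he.lintegral_comp hf, ← he.lintegral_comp hg, ← he.lintegral_comp hh]
  refine hμ t ht0 ht1 _ _ _ (hf.comp he.measurable) (hg.comp he.measurable)
    (hh.comp he.measurable) fun x y => ?_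
  simpa using hfgh (e x) (e y)

/-- The Prékopa-Leindler inequality in `ℝⁿ`. -/
theorem prekopaLeindler_volume_pi (n : ℕ) :
    PrekopaLeindler (volume : Measure (Fin n → ℝ)) := by
  induction n with
  | zero =>
    intro t ht0 ht1 f g h hf hg hh hfgh
    rw [volume_pi, Measure.pi_of_empty _ default]
    simp only [lintegral_dirac]
    convert hfgh default default using 2
  | succ n ih =>
    have e := (volume_preserving_piFinSuccAbove (fun _ : Fin (n + 1) => ℝ) 0).symm
    exact (Real.prekopaLeindler_volume.prod ih).of_measurePreserving
      (e := { toFun := fun p : ℝ × (Fin n → ℝ) =>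
                (MeasurableEquiv.piFinSuccAbove (fun _ : Fin (n + 1) => ℝ) 0).symm p
              map_add' := fun p q => by
                ext i; refine Fin.cases ?_ (fun j => ?_) i <;> simp [MeasurableEquiv.piFinSuccAbove]
              map_smul' := fun c p => by
                ext i; refine Fin.cases ?_ (fun j => ?_) i <;> simp [MeasurableEquiv.piFinSuccAbove] })
      e

/-! ### From log-concave measures to log-concave densities. -/

theorem IsLogConcaveMeasure.map {E F : Type*} [AddCommGroup E] [Module ℝ E] [MeasurableSpace E]
    [AddCommGroup F] [Module ℝ F] [MeasurableSpace F] {μ : Measure E}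
    (hμ : IsLogConcaveMeasure μ) (L : E →ₗ[ℝ] F) (hL : Measurable L) :
    IsLogConcaveMeasure (μ.map L) := by
  intro A B hA hB t ht0 ht1
  rw [Measure.map_apply hL hA, Measure.map_apply hL hB]
  refine (hμ _ _ (hL hA) (hL hB) t ht0 ht1).trans
    ((measure_mono ?_).trans (Measure.le_map_apply hL.aemeasurable _))
  rintro _ ⟨_, ⟨x, hx, rfl⟩, _, ⟨y, hy, rfl⟩, rfl⟩
  exact ⟨t • L x, ⟨L x, hx, rfl⟩, (1 - t) • L y, ⟨L y, hy, rfl⟩, by simp⟩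

theorem IsLogConcaveMeasure.measure_closedBall_le {E : Type*} [NormedAddCommGroup E]
    [NormedSpace ℝ E] [MeasurableSpace E] [BorelSpace E] {ν : Measure E}
    (hν : IsLogConcaveMeasure ν) {t : ℝ} (ht0 : 0 < t) (ht1 : t < 1) (x y : E) (r : ℝ) :
    ν (Metric.closedBall x r) ^ t * ν (Metric.closedBall y r) ^ (1 - t)
      ≤ ν (Metric.closedBall (t • x + (1 - t) • y) r) := by
  refine (hν _ _ measurableSet_closedBall measurableSet_closedBall t ht0 ht1).trans
    (measure_mono ?_)
  rintro _ ⟨_, ⟨x', hx, rfl⟩, _, ⟨y', hy, rfl⟩, rfl⟩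
  simp only [mem_closedBall_iff_norm] at hx hy ⊢
  calc ‖t • x' + (1 - t) • y' - (t • x + (1 - t) • y)‖
      = ‖t • (x' - x) + (1 - t) • (y' - y)‖ := by congr 1; module
    _ ≤ t * ‖x' - x‖ + (1 - t) * ‖y' - y‖ := by
        refine (norm_add_le _ _).trans_eq ?_
        rw [norm_smul, norm_smul, Real.norm_of_nonneg ht0.le,
          Real.norm_of_nonneg (sub_pos.2 ht1).le]
    _ ≤ t * r + (1 - t) * r := by
        have := sub_pos.2 ht1
        gcongr
    _ = r := by ring

/-- A density of a log-concave measure is log-concave on a measurable set of full measure. -/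
theorem IsLogConcaveMeasure.exists_logConcave_density {n : ℕ} {ν : Measure (Fin n → ℝ)}
    [IsFiniteMeasure ν] (hν : IsLogConcaveMeasure ν) {u : (Fin n → ℝ) → ℝ≥0∞} (hu : Measurable u)
    (hd : ν = volume.withDensity u) :
    ∃ D : Set (Fin n → ℝ), MeasurableSet D ∧ (∀ᵐ x, x ∈ D) ∧
      ∀ t : ℝ, 0 < t → t < 1 → ∀ x ∈ D, ∀ y ∈ D, t • x + (1 - t) • y ∈ D →
        u x ^ t * u y ^ (1 - t) ≤ u (t • x + (1 - t) • y) := by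
  have hfin : ∀ᵐ x, u x < ⊤ := by
    refine ae_lt_top hu ?_
    have : ν Set.univ ≠ ⊤ := measure_ne_top _ _
    rwa [hd, withDensity_apply _ MeasurableSet.univ, Measure.restrict_univ] at this
  -- `D` will consist of points where `u` is finite and is the limit of ball averages; the
  -- inequality for balls of equal radius then passes to the limit. Since `D` need not be convex,
  -- the intermediate point must be required to lie in it.
  have hrn : ν.rnDeriv volume =ᵐ[volume] u := by
    rw [hd]; exact Measure.rnDeriv_withDensity volume hu
  have hlim : ∀ᵐ x : Fin n → ℝ, u x ≠ ⊤ ∧ Tendsto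
      (fun r => ν (Metric.closedBall x r) / volume (Metric.closedBall x r)) (𝓝[>] 0)
      (𝓝 (u x)) := by
    filter_upwards [hfin, hrn, Besicovitch.ae_tendsto_rnDeriv ν volume] with x h1 h2 h3
    exact ⟨h1.ne, h2 ▸ h3⟩
  obtain ⟨D, hDae, hDm, hD⟩ := hlim.exists_measurable_mem
  refine ⟨D, hDm, hDae, fun t ht0 ht1 x hx y hy hz => ?_⟩
  have ht1' := sub_pos.2 ht1
  refine le_of_tendsto_of_tendsto (ENNReal.Tendsto.mul
    ((ENNReal.continuous_rpow_const.tendsto _).comp (hD x hx).2)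
    (Or.inr (ENNReal.rpow_ne_top_of_nonneg ht1'.le (hD y hy).1))
    ((ENNReal.continuous_rpow_const.tendsto _).comp (hD y hy).2)
    (Or.inr (ENNReal.rpow_ne_top_of_nonneg ht0.le (hD x hx).1))) (hD _ hz).2 ?_
  filter_upwards [self_mem_nhdsWithin] with r (hr : 0 < r)
  simp only [Function.comp_apply]
  have hV : ∀ z : Fin n → ℝ, volume (Metric.closedBall z r)
      = volume (Metric.closedBall (0 : Fin n → ℝ) r) :=
    fun z => Measure.addHaar_closedBall_center volume z r
  rw [hV x, hV y, hV (t • x + (1 - t) • y)]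
  set V := volume (Metric.closedBall (0 : Fin n → ℝ) r)
  have hV0 : V ≠ 0 := (Metric.measure_closedBall_pos volume _ hr).ne'
  have hVt : V ≠ ⊤ := measure_closedBall_lt_top.ne
  rw [ENNReal.div_rpow_of_nonneg _ _ ht0.le, ENNReal.div_rpow_of_nonneg _ _ ht1'.le,
    ← ENNReal.mul_div_mul_comm (Or.inr (ENNReal.rpow_ne_top_of_nonneg ht1'.le hVt))
      (Or.inl (ENNReal.rpow_ne_top_of_nonneg ht0.le hVt)), ← ENNReal.rpow_add _ _ hV0 hVt]
  rw [add_sub_cancel, ENNReal.rpow_one]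
  gcongr
  exact hν.measure_closedBall_le ht0 ht1 x y r

/-! ### Integrals of powers of the density. -/

theorem lintegral_comp_inv_smul {n : ℕ} {f : (Fin n → ℝ) → ℝ≥0∞} (hf : Measurable f) {a : ℝ}
    (ha : 0 < a) : ∫⁻ x, f (a⁻¹ • x) = ENNReal.ofReal (a ^ n) * ∫⁻ x, f x := by
  rw [← lintegral_map hf (measurable_const_smul a⁻¹),
    Measure.map_addHaar_smul _ (inv_ne_zero ha.ne'), lintegral_smul_measure]
  simp [abs_of_pos ha]

/-- For a density `u` of a log-concave measure on `ℝⁿ`, the function `α ↦ αⁿ ∫ u ^ α` is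
log-concave on the positive half-line. -/
theorem IsLogConcaveMeasure.scaled_lintegral_rpow_le {n : ℕ} {ν : Measure (Fin n → ℝ)}
    [IsFiniteMeasure ν] (hν : IsLogConcaveMeasure ν) {u : (Fin n → ℝ) → ℝ≥0∞} (hu : Measurable u)
    (hd : ν = volume.withDensity u) {t α β : ℝ} (ht0 : 0 < t) (ht1 : t < 1) (hα : 0 < α)
    (hβ : 0 < β) :
    (ENNReal.ofReal (α ^ n) * ∫⁻ x, u x ^ α) ^ t *
        (ENNReal.ofReal (β ^ n) * ∫⁻ x, u x ^ β) ^ (1 - t)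
      ≤ ENNReal.ofReal ((t * α + (1 - t) * β) ^ n) * ∫⁻ x, u x ^ (t * α + (1 - t) * β) := by
  classical
  obtain ⟨D, hDm, hDae, hD⟩ := hν.exists_logConcave_density hu hd
  have ht1' := sub_pos.2 ht1
  set γ := t * α + (1 - t) * β with hγdef
  have hγ : 0 < γ := by positivity
  -- Off the null set `Dᶜ`, `v` and `w` agree with `u`; on it they are `0` and `∞`, making the
  -- pointwise hypothesis trivial when a point leaves `D`.
  set v := D.indicator u
  set w : (Fin n → ℝ) → ℝ≥0∞ := D.piecewise u ⊤
  have hv : Measurable v := hu.indicator hDm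
  have hw : Measurable w := hu.piecewise hDm measurable_const
  have hvI : ∀ a : ℝ, ∫⁻ x, u x ^ a = ∫⁻ x, v x ^ a := fun a => lintegral_congr_ae <| by
    filter_upwards [hDae] with x hx
    simp [v, hx]
  have hwI : ∀ a : ℝ, ∫⁻ x, u x ^ a = ∫⁻ x, w x ^ a := fun a => lintegral_congr_ae <| by
    filter_upwards [hDae] with x hx
    simp [w, hx]
  rw [hvI α, hvI β, hwI γ, ← lintegral_comp_inv_smul (hv.pow_const α) hα,
    ← lintegral_comp_inv_smul (hv.pow_const β) hβ, ← lintegral_comp_inv_smul (hw.pow_const γ) hγ]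
  refine prekopaLeindler_volume_pi n t ht0 ht1 _ _ _
    ((hv.pow_const α).comp (measurable_const_smul _))
    ((hv.pow_const β).comp (measurable_const_smul _))
    ((hw.pow_const γ).comp (measurable_const_smul _)) fun x y => ?_
  by_cases hx : α⁻¹ • x ∈ D
  swap
  · simp [v, hx, hα, ht0]
  by_cases hy : β⁻¹ • y ∈ D
  swap
  · simp [v, hy, hβ, ht1]
  by_cases hz : γ⁻¹ • (t • x + (1 - t) • y) ∈ D
  swap
  · simp [w, hz, hγ, -smul_add]
  -- The dilations turn the weights `t, 1 - t` into `tα/γ, (1 - t)β/γ`; raising log-concavity of `u`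
  -- to the power `γ` restores the exponents.
  have hs0 : 0 < t * α / γ := by positivity
  have hs1' : 1 - t * α / γ = (1 - t) * β / γ := by field_simp; rw [hγdef]; ring
  have hs1 : t * α / γ < 1 := by
    rw [← sub_pos, hs1']; positivity
  have hcomb : γ⁻¹ • (t • x + (1 - t) • y)
      = (t * α / γ) • (α⁻¹ • x) + (1 - t * α / γ) • (β⁻¹ • y) := by
    rw [hs1', smul_add, smul_smul, smul_smul, smul_smul, smul_smul]
    congr 2 <;> field_simp
  have key := hD _ hs0 hs1 _ hx _ hy (hcomb ▸ hz)
  rw [← hcomb, hs1'] at key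
  simp only [v, w, Set.indicator_of_mem hx, Set.indicator_of_mem hy, Set.piecewise_eq_of_mem _ _ _ hz]
  calc (u (α⁻¹ • x) ^ α) ^ t * (u (β⁻¹ • y) ^ β) ^ (1 - t)
      = (u (α⁻¹ • x) ^ (t * α / γ) * u (β⁻¹ • y) ^ ((1 - t) * β / γ)) ^ γ := by
        rw [ENNReal.mul_rpow_of_nonneg _ _ hγ.le, ← ENNReal.rpow_mul, ← ENNReal.rpow_mul,
          ← ENNReal.rpow_mul, ← ENNReal.rpow_mul]
        congr 2 <;> field_simp
    _ ≤ _ := by gcongr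

/-- Put `1` strictly between `α` and some `β`: an infinite integral at `α` would, by log-concavity,
force `∫ u = ∞`. -/
theorem IsLogConcaveMeasure.lintegral_rpow_ne_top {n : ℕ} {ν : Measure (Fin n → ℝ)}
    [IsProbabilityMeasure ν] (hν : IsLogConcaveMeasure ν) {u : (Fin n → ℝ) → ℝ≥0∞}
    (hu : Measurable u) (hd : ν = volume.withDensity u) {α : ℝ} (hα : 0 < α) :
    ∫⁻ x, u x ^ α ≠ 0 ∧ ∫⁻ x, u x ^ α ≠ ⊤ := by
  have hone : ∫⁻ x, u x = 1 := by
    have : ν Set.univ = 1 := measure_univ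
    rwa [hd, withDensity_apply _ MeasurableSet.univ, Measure.restrict_univ] at this
  have hpos : ∀ a : ℝ, 0 < a → ∫⁻ x, u x ^ a ≠ 0 := by
    intro a ha h0
    rw [lintegral_eq_zero_iff (hu.pow_const a)] at h0
    have : u =ᵐ[volume] 0 := by
      filter_upwards [h0] with x hx
      simpa [ENNReal.rpow_eq_zero_iff, ha, ha.not_gt] using hx
    rw [lintegral_congr_ae this] at hone
    simp at hone
  refine ⟨hpos α hα, fun htop => ?_⟩
  obtain ⟨t, β, ht0, ht1, hβ, hcomb⟩ :
      ∃ t β : ℝ, 0 < t ∧ t < 1 ∧ 0 < β ∧ t * α + (1 - t) * β = 1 := by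
    rcases lt_trichotomy α 1 with h | h | h
    · refine ⟨1 / (2 - α), 2, by apply one_div_pos.2; linarith, ?_, two_pos, ?_⟩
      · rw [div_lt_one (by linarith)]; linarith
      · have : 2 - α ≠ 0 := by linarith
        field_simp; ring
    · simp [h, hone] at htop
    · refine ⟨1 / (2 * α - 1), 1 / 2, by apply one_div_pos.2; linarith, ?_, by norm_num, ?_⟩
      · rw [div_lt_one (by linarith)]; linarith
      · have : 2 * α - 1 ≠ 0 := by linarith
        field_simp; ring
  have h := hν.scaled_lintegral_rpow_le hu hd ht0 ht1 hα hβ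
  have hβ0 : (ENNReal.ofReal (β ^ n) * ∫⁻ x, u x ^ β) ^ (1 - t) ≠ 0 := by
    have h1 : ENNReal.ofReal (β ^ n) * ∫⁻ x, u x ^ β ≠ 0 :=
      mul_ne_zero (by simpa using pow_pos hβ n) (hpos β hβ)
    simp [ENNReal.rpow_eq_zero_iff, h1, ht1.not_gt, -mul_eq_zero]
  rw [hcomb, htop, ENNReal.mul_top (by simpa using pow_pos hα n), ENNReal.top_rpow_of_pos ht0,
    ENNReal.top_mul hβ0] at h
  simp [hone] at h

/-! ### Cumulant generating function and concentration of `log f`. -/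

theorem IsLebesgueDensity.lintegral_exp_mul_log {n : ℕ} {ν : Measure (Fin n → ℝ)}
    {f : (Fin n → ℝ) → ℝ} (hf : IsLebesgueDensity ν f) {s : ℝ} (hs : -1 < s) :
    ∫⁻ x, ENNReal.ofReal (Real.exp (s * Real.log (f x))) ∂ν
      = ∫⁻ x, ENNReal.ofReal (f x) ^ (1 + s) := by
  have hm : AEMeasurable (fun x => ENNReal.ofReal (Real.exp (s * Real.log (f x)))) volume :=
    (Real.measurable_exp.comp_aemeasurable
      ((Real.measurable_log.comp_aemeasurable hf.aemeasurable).const_mul s)).ennreal_ofReal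
  rw [hf.eq_withDensity, lintegral_withDensity_eq_lintegral_mul₀ hf.aemeasurable.ennreal_ofReal hm]
  refine lintegral_congr fun x => ?_
  -- Where `f = 0`, `Real.log 0 = 0` makes the exponential `1`, but its weight is `0`, matching `0 ^
  -- (1 + s)` because `s > -1`.
  rcases (hf.nonneg x).eq_or_lt with h | h
  · simp [← h, show 0 < 1 + s by linarith]
  · rw [Pi.mul_apply, ← ENNReal.ofReal_mul h.le, ENNReal.ofReal_rpow_of_pos h, Real.rpow_add h,
      Real.rpow_one, Real.rpow_def_of_pos h, mul_comm s]

theorem IsLebesgueDensity.integral_log {n : ℕ} {ν : Measure (Fin n → ℝ)}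
    {f : (Fin n → ℝ) → ℝ} (hf : IsLebesgueDensity ν f) :
    ∫ x, Real.log (f x) ∂ν = -densityEntropy f := by
  rw [densityEntropy, neg_neg]
  conv_lhs => rw [hf.eq_withDensity]
  rw [integral_withDensity_eq_integral_toReal_smul₀ hf.aemeasurable.ennreal_ofReal (by simp)]
  simp [ENNReal.toReal_ofReal, hf.nonneg]

theorem IsLebesgueDensity.integrable_log_iff {n : ℕ} {ν : Measure (Fin n → ℝ)}
    {f : (Fin n → ℝ) → ℝ} (hf : IsLebesgueDensity ν f) :
    Integrable (fun x => Real.log (f x)) ν ↔ Integrable (fun x => f x * Real.log (f x)) := by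
  conv_lhs => rw [hf.eq_withDensity]
  rw [integrable_withDensity_iff_integrable_smul₀' hf.aemeasurable.ennreal_ofReal (by simp)]
  simp [ENNReal.toReal_ofReal, hf.nonneg]

theorem IsLebesgueDensity.mgf_log {n : ℕ} {ν : Measure (Fin n → ℝ)}
    {f : (Fin n → ℝ) → ℝ} (hf : IsLebesgueDensity ν f) {s : ℝ} (hs : -1 < s) :
    ProbabilityTheory.mgf (fun x => Real.log (f x)) ν s
      = (∫⁻ x, ENNReal.ofReal (f x) ^ (1 + s)).toReal := by
  have hac : ν ≪ volume := hf.eq_withDensity ▸ withDensity_absolutelyContinuous _ _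
  have hm : AEMeasurable (fun x => Real.exp (s * Real.log (f x))) ν :=
    (Real.measurable_exp.comp_aemeasurable
      ((Real.measurable_log.comp_aemeasurable hf.aemeasurable).const_mul s)).mono_ac hac
  rw [ProbabilityTheory.mgf, integral_eq_lintegral_of_nonneg_ae
    (Eventually.of_forall fun x => (Real.exp_pos _).le) hm.aestronglyMeasurable,
    hf.lintegral_exp_mul_log hs]

namespace IsLogConcaveMeasure

variable {n : ℕ} {ν : Measure (Fin n → ℝ)} [IsProbabilityMeasure ν]
  {f : (Fin n → ℝ) → ℝ}

theorem scaled_lintegral_density_rpow_le (hν : IsLogConcaveMeasure ν) (hf : IsLebesgueDensity ν f)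
    {t α β : ℝ} (ht0 : 0 < t) (ht1 : t < 1) (hα : 0 < α) (hβ : 0 < β) :
    (ENNReal.ofReal (α ^ n) * ∫⁻ x, ENNReal.ofReal (f x) ^ α) ^ t *
        (ENNReal.ofReal (β ^ n) * ∫⁻ x, ENNReal.ofReal (f x) ^ β) ^ (1 - t)
      ≤ ENNReal.ofReal ((t * α + (1 - t) * β) ^ n) *
          ∫⁻ x, ENNReal.ofReal (f x) ^ (t * α + (1 - t) * β) := by
  have hm := hf.aemeasurable.ennreal_ofReal
  have hI : ∀ a : ℝ, ∫⁻ x, ENNReal.ofReal (f x) ^ a = ∫⁻ x, hm.mk _ x ^ a := fun a =>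
    lintegral_congr_ae (by filter_upwards [hm.ae_eq_mk] with x hx; rw [hx])
  rw [hI, hI, hI]
  exact hν.scaled_lintegral_rpow_le hm.measurable_mk
    (hf.eq_withDensity.trans (withDensity_congr_ae hm.ae_eq_mk)) ht0 ht1 hα hβ

theorem lintegral_density_rpow_ne (hν : IsLogConcaveMeasure ν) (hf : IsLebesgueDensity ν f)
    {α : ℝ} (hα : 0 < α) :
    ∫⁻ x, ENNReal.ofReal (f x) ^ α ≠ 0 ∧ ∫⁻ x, ENNReal.ofReal (f x) ^ α ≠ ⊤ := by
  have hm := hf.aemeasurable.ennreal_ofReal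
  have hI : ∫⁻ x, ENNReal.ofReal (f x) ^ α = ∫⁻ x, hm.mk _ x ^ α :=
    lintegral_congr_ae (by filter_upwards [hm.ae_eq_mk] with x hx; rw [hx])
  rw [hI]
  exact hν.lintegral_rpow_ne_top hm.measurable_mk
    (hf.eq_withDensity.trans (withDensity_congr_ae hm.ae_eq_mk)) hα

theorem integrable_exp_mul_log (hν : IsLogConcaveMeasure ν) (hf : IsLebesgueDensity ν f) {s : ℝ}
    (hs : -1 < s) : Integrable (fun x => Real.exp (s * Real.log (f x))) ν := by
  have hac : ν ≪ volume := hf.eq_withDensity ▸ withDensity_absolutelyContinuous _ _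
  have hm : AEMeasurable (fun x => Real.exp (s * Real.log (f x))) ν :=
    (Real.measurable_exp.comp_aemeasurable
      ((Real.measurable_log.comp_aemeasurable hf.aemeasurable).const_mul s)).mono_ac hac
  refine ⟨hm.aestronglyMeasurable, ?_⟩
  rw [hasFiniteIntegral_iff_ofReal (Eventually.of_forall fun x => (Real.exp_pos _).le),
    hf.lintegral_exp_mul_log hs]
  exact (hν.lintegral_density_rpow_ne hf (by linarith)).2.lt_top

theorem zero_mem_interior_integrableExpSet (hν : IsLogConcaveMeasure ν)
    (hf : IsLebesgueDensity ν f) :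
    0 ∈ interior (ProbabilityTheory.integrableExpSet (fun x => Real.log (f x)) ν) :=
  mem_interior.2 ⟨Set.Ioi (-1), fun _ hs => hν.integrable_exp_mul_log hf hs, isOpen_Ioi,
    by simp⟩

theorem concaveOn_cgf_log_density (hν : IsLogConcaveMeasure ν) (hf : IsLebesgueDensity ν f) :
    ConcaveOn ℝ (Set.Ioi (-1)) fun s =>
      ProbabilityTheory.cgf (fun x => Real.log (f x)) ν s + n * Real.log (1 + s) := by
  have hφ : ∀ s : ℝ, -1 < s →
      ProbabilityTheory.cgf (fun x => Real.log (f x)) ν s + n * Real.log (1 + s)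
        = Real.log (ENNReal.ofReal ((1 + s) ^ n) *
            ∫⁻ x, ENNReal.ofReal (f x) ^ (1 + s)).toReal := by
    intro s hs
    have hs' : 0 < 1 + s := by linarith
    have h := hν.lintegral_density_rpow_ne hf hs'
    rw [ProbabilityTheory.cgf, hf.mgf_log hs, ENNReal.toReal_mul,
      ENNReal.toReal_ofReal (by positivity), Real.log_mul (by positivity)
      (ENNReal.toReal_ne_zero.2 h), Real.log_pow, add_comm]
  refine concaveOn_iff_forall_pos.2 ⟨convex_Ioi _, fun a ha b hb t t' ht ht' htt => ?_⟩
  obtain rfl : t' = 1 - t := by linarith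
  simp only [Set.mem_Ioi] at ha hb
  have ha' : 0 < 1 + a := by linarith
  have hb' : 0 < 1 + b := by linarith
  have hc : 1 + (t * a + (1 - t) * b) = t * (1 + a) + (1 - t) * (1 + b) := by ring
  have hc0 : 0 < 1 + (t * a + (1 - t) * b) := by rw [hc]; positivity
  simp only [smul_eq_mul]
  rw [hφ a ha, hφ b hb, hφ _ (by linarith)]
  have key := hν.scaled_lintegral_density_rpow_le hf ht (by linarith) ha' hb'
  rw [← hc] at key
  have pos : ∀ s : ℝ, 0 < 1 + s →
      0 < (ENNReal.ofReal ((1 + s) ^ n) * ∫⁻ x, ENNReal.ofReal (f x) ^ (1 + s)).toReal := by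
    intro s hs
    have h := hν.lintegral_density_rpow_ne hf hs
    rw [ENNReal.toReal_mul]
    exact mul_pos (by rw [ENNReal.toReal_ofReal (by positivity)]; positivity)
      (ENNReal.toReal_pos h.1 h.2)
  have key' := ENNReal.toReal_mono (ENNReal.mul_ne_top ENNReal.ofReal_ne_top
    (hν.lintegral_density_rpow_ne hf hc0).2) key
  rw [ENNReal.toReal_mul, ← ENNReal.toReal_rpow, ← ENNReal.toReal_rpow] at key'
  have hpa := pos a ha'
  have hpb := pos b hb'
  rw [← Real.log_rpow hpa, ← Real.log_rpow hpb, ← Real.log_mul (by positivity) (by positivity)]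
  exact Real.log_le_log (by positivity) key'

/-- The cumulant generating function of the information content of a log-concave density is
dominated by the one of the exponential distribution. -/
theorem cgf_log_density_le (hν : IsLogConcaveMeasure ν) (hf : IsLebesgueDensity ν f) {s : ℝ}
    (hs : -1 < s) :
    ProbabilityTheory.cgf (fun x => Real.log (f x)) ν s
      ≤ s * ∫ x, Real.log (f x) ∂ν + n * (s - Real.log (1 + s)) := by
  set m := ∫ x, Real.log (f x) ∂ν with hm
  set φ := fun s => ProbabilityTheory.cgf (fun x => Real.log (f x)) ν s + n * Real.log (1 + s)
    with hφ
  have h0 := hν.zero_mem_interior_integrableExpSet hf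
  have hd1 : HasDerivAt (ProbabilityTheory.cgf (fun x => Real.log (f x)) ν) m 0 := by
    have := (ProbabilityTheory.analyticAt_cgf h0).differentiableAt.hasDerivAt
    rw [ProbabilityTheory.deriv_cgf_zero h0] at this
    simpa using this
  have hd2 : HasDerivAt (fun s : ℝ => n * Real.log (1 + s)) (n * (1 / (1 + 0))) 0 :=
    (((hasDerivAt_id (0 : ℝ)).const_add 1).log (by norm_num)).const_mul _
  have hd : HasDerivAt φ (m + n) 0 := by
    have h := hd1.add hd2
    rw [add_zero, div_one, mul_one] at h
    exact h
  have hconc : ConcaveOn ℝ (Set.Ioi (-1)) φ := hν.concaveOn_cgf_log_density hf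
  have hφ0 : φ 0 = 0 := by simp [hφ]
  have h0m : (0 : ℝ) ∈ Set.Ioi (-1 : ℝ) := by simp
  -- A concave function lies below its tangent at `0`, where `φ` vanishes with slope `m + n`.
  have main : φ s ≤ s * (m + n) := by
    rcases lt_trichotomy s 0 with h | h | h
    · have := hconc.le_slope_of_hasDerivAt hs h0m h hd
      rw [slope_def_field, hφ0, le_div_iff₀ (by linarith)] at this
      linarith
    · simp [h, hφ0]
    · have := hconc.slope_le_of_hasDerivAt h0m hs h hd
      rw [slope_def_field, hφ0, div_le_iff₀ (by linarith)] at this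
      linarith
  simp only [hφ] at main
  linarith

theorem measureReal_log_density_ge_le (hν : IsLogConcaveMeasure ν) (hf : IsLebesgueDensity ν f)
    {ε : ℝ} (hε : 0 < ε) :
    ν.real {x | ∫ y, Real.log (f y) ∂ν + n * ε ≤ Real.log (f x)}
      ≤ Real.exp (-(n * (ε ^ 2 / 4))) := by
  -- Chernoff at `s = ε/2`: the exponent is at most `-nε²/2 + n(ε/2)²`.
  refine (ProbabilityTheory.measure_ge_le_exp_cgf (t := ε / 2) _ (by positivity)
    (hν.integrable_exp_mul_log hf (by linarith))).trans (Real.exp_le_exp.2 ?_)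
  have h1 := hν.cgf_log_density_le hf (s := ε / 2) (by linarith)
  have h2 : ε / 2 - Real.log (1 + ε / 2) ≤ (ε / 2) ^ 2 := by
    have h3 := Real.one_sub_inv_le_log_of_pos (x := 1 + ε / 2) (by positivity)
    have h4 : 1 - (1 + ε / 2)⁻¹ = ε / 2 / (1 + ε / 2) := by field_simp; ring
    have h5 : ε / 2 - (ε / 2) ^ 2 ≤ ε / 2 / (1 + ε / 2) := by
      rw [le_div_iff₀ (by positivity)]
      nlinarith [pow_pos hε 3]
    linarith
  have h6 := mul_le_mul_of_nonneg_left h2 (Nat.cast_nonneg (α := ℝ) n)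
  nlinarith

theorem measureReal_log_density_le_le (hν : IsLogConcaveMeasure ν) (hf : IsLebesgueDensity ν f)
    {ε : ℝ} (hε : 0 < ε) (hε1 : ε ≤ 1) :
    ν.real {x | Real.log (f x) ≤ ∫ y, Real.log (f y) ∂ν - n * ε}
      ≤ Real.exp (-(n * (ε ^ 2 / 8))) := by
  -- Chernoff at `s = -ε/4`, kept away from the singularity `-1` by `ε ≤ 1`: the exponent is at most
  -- `-nε²/4 + 2n(ε/4)²`.
  refine (ProbabilityTheory.measure_le_le_exp_cgf (t := -(ε / 4)) _ (by linarith)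
    (hν.integrable_exp_mul_log hf (by linarith))).trans (Real.exp_le_exp.2 ?_)
  have h1 := hν.cgf_log_density_le hf (s := -(ε / 4)) (by linarith)
  have h2 : -(ε / 4) - Real.log (1 + -(ε / 4)) ≤ 2 * (ε / 4) ^ 2 := by
    have hpos : 0 < 1 + -(ε / 4) := by linarith
    have h3 := Real.one_sub_inv_le_log_of_pos hpos
    have h5 : (1 + -(ε / 4))⁻¹ ≤ 1 + ε / 4 + 2 * (ε / 4) ^ 2 := by
      rw [inv_le_iff_one_le_mul₀ hpos]
      nlinarith [pow_pos hε 2, pow_pos hε 3]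
    linarith
  have h6 := mul_le_mul_of_nonneg_left h2 (Nat.cast_nonneg (α := ℝ) n)
  nlinarith

/-- The information content of a log-concave density concentrates around the entropy. -/
theorem measure_abs_log_density_add_entropy_ge_le (hν : IsLogConcaveMeasure ν)
    (hf : IsLebesgueDensity ν f) {ε : ℝ} (hε : 0 < ε) (hε1 : ε ≤ 1) :
    ν {x | n * ε ≤ |Real.log (f x) + densityEntropy f|}
      ≤ ENNReal.ofReal (2 * Real.exp (-(n * (ε ^ 2 / 8)))) := by
  have hm := hf.integral_log
  rw [← ofReal_measureReal]
  refine ENNReal.ofReal_le_ofReal ?_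
  calc ν.real {x | n * ε ≤ |Real.log (f x) + densityEntropy f|}
      ≤ ν.real ({x | ∫ y, Real.log (f y) ∂ν + n * ε ≤ Real.log (f x)} ∪
          {x | Real.log (f x) ≤ ∫ y, Real.log (f y) ∂ν - n * ε}) := by
        refine measureReal_mono fun x hx => ?_
        rw [hm]
        rcases le_abs.1 (show
          n * ε ≤ |Real.log (f x) + densityEntropy f| from hx) with h | h
        · exact Or.inl (by rw [Set.mem_ofPred_eq]; linarith)
        · exact Or.inr (by rw [Set.mem_ofPred_eq]; linarith)
    _ ≤ Real.exp (-(n * (ε ^ 2 / 4))) + Real.exp (-(n * (ε ^ 2 / 8))) :=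
        (measureReal_union_le _ _).trans (add_le_add (hν.measureReal_log_density_ge_le hf hε)
          (hν.measureReal_log_density_le_le hf hε hε1))
    _ ≤ Real.exp (-(n * (ε ^ 2 / 8))) + Real.exp (-(n * (ε ^ 2 / 8))) := by
        gcongr ?_ + _
        refine Real.exp_le_exp.2 (neg_le_neg ?_)
        gcongr
        norm_num
    _ = _ := by ring

end IsLogConcaveMeasure

/-! ### Almost sure convergence. -/

theorem IsLogConcaveMeasure.map_initialVector {Ω : Type*} [MeasurableSpace Ω] {P : Measure Ω}
    {X : ℕ → Ω → ℝ} (hX : ∀ i, Measurable (X i))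
    (hlc : IsLogConcaveMeasure (P.map (processPath X))) (n : ℕ) :
    IsLogConcaveMeasure (P.map (initialVector X n)) := by
  have hL : Measurable (LinearMap.funLeft ℝ ℝ (fun i : Fin n => (i : ℕ))) :=
    measurable_pi_lambda _ fun i => measurable_pi_apply _
  have h := hlc.map _ hL
  have hpath : Measurable (processPath X) := measurable_pi_lambda _ hX
  rwa [Measure.map_map hL hpath] at h

/-- If the tails of `Y n` beyond `n * ε` are summable for all small `ε`, then `Y n / n → 0` almost
surely. -/
theorem ae_tendsto_div_natCast_of_tsum_ne_top {Ω : Type*} [MeasurableSpace Ω] {P : Measure Ω}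
    {Y : ℕ → Ω → ℝ} (h : ∀ ε : ℝ, 0 < ε → ε ≤ 1 → ∑' n : ℕ, P {ω | n * ε ≤ |Y n ω|} ≠ ⊤) :
    ∀ᵐ ω ∂P, Tendsto (fun n : ℕ => Y n ω / n) atTop (𝓝 0) := by
  -- Borel-Cantelli for each of the countably many thresholds `1/(k + 1)`.
  have hall : ∀ᵐ ω ∂P, ∀ k : ℕ, ∀ᶠ n : ℕ in atTop, ω ∉ {ω | n * (1 / ((k : ℝ) + 1)) ≤ |Y n ω|} :=
    ae_all_iff.2 fun k => ae_eventually_notMem (h _ Nat.one_div_pos_of_nat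
      (by rw [div_le_one (by positivity)]; linarith [Nat.cast_nonneg (α := ℝ) k]))
  filter_upwards [hall] with ω hω
  rw [Metric.tendsto_atTop']
  intro ε hε
  obtain ⟨k, hk⟩ := exists_nat_one_div_lt hε
  obtain ⟨N, hN⟩ := eventually_atTop.1 (hω k)
  refine ⟨N, fun n hn => ?_⟩
  have h1 : |Y n ω| < n * (1 / ((k : ℝ) + 1)) := not_le.1 (hN n hn.le)
  have hn0 : (0 : ℝ) < n := by exact_mod_cast (Nat.zero_le N).trans_lt hn
  rw [dist_zero_right, Real.norm_eq_abs, abs_div, abs_of_pos hn0, div_lt_iff₀ hn0]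
  nlinarith

theorem tsum_ofReal_exp_neg_mul_ne_top {c : ℝ} (hc : 0 < c) :
    ∑' n : ℕ, ENNReal.ofReal (2 * Real.exp (-(n * c))) ≠ ⊤ := by
  have hs : Summable fun n : ℕ => 2 * Real.exp (-(n * c)) := by
    simpa using (Real.summable_exp_nat_mul_iff.2 (neg_lt_zero.2 hc)).mul_left 2
  exact hs.tsum_ofReal_ne_top

theorem corollary1p3 {Ω : Type*} [MeasurableSpace Ω] (P : Measure Ω) [IsProbabilityMeasure P]
    (X : ℕ → Ω → ℝ) (hX : ∀ i, Measurable (X i))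
    (hlc : IsLogConcaveMeasure (P.map (processPath X)))
    (hac : ∀ n, P.map (initialVector X n) ≪ volume)
    (f : (n : ℕ) → (Fin n → ℝ) → ℝ)
    (hf : ∀ n, IsLebesgueDensity (P.map (initialVector X n)) (f n)) :
    (∀ n, Integrable (fun x => f n x * Real.log (f n x)) volume) ∧
    ∀ h : EReal,
      Tendsto (fun n : ℕ => ((densityEntropy (f n) / (n : ℝ) : ℝ) : EReal)) atTop (𝓝 h) →
      ∀ᵐ ω ∂P, Tendsto
        (fun n : ℕ => ((-(1 / (n : ℝ)) * Real.log (f n (initialVector X n ω)) : ℝ) : EReal))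
        atTop (𝓝 h) := by
  have hXn : ∀ n, Measurable (initialVector X n) := fun n =>
    measurable_pi_lambda _ fun i => hX i
  have hprob : ∀ n, IsProbabilityMeasure (P.map (initialVector X n)) := fun n =>
    Measure.isProbabilityMeasure_map (hXn n).aemeasurable
  have hν := hlc.map_initialVector hX
  refine ⟨fun n => (hf n).integrable_log_iff.1
    (ProbabilityTheory.integrable_of_mem_interior_integrableExpSet
      ((hν n).zero_mem_interior_integrableExpSet (hf n))), fun h hh => ?_⟩
  have hconv : ∀ᵐ ω ∂P, Tendsto (fun n : ℕ =>
      (Real.log (f n (initialVector X n ω)) + densityEntropy (f n)) / n) atTop (𝓝 0) := by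
    refine ae_tendsto_div_natCast_of_tsum_ne_top fun ε hε hε1 => ?_
    refine ne_top_of_le_ne_top (tsum_ofReal_exp_neg_mul_ne_top (c := ε ^ 2 / 8) (by positivity))
      (ENNReal.tsum_le_tsum fun n => ?_)
    -- `f n` is only a.e. measurable, so the deviation set may fail to be measurable; this
    -- inequality needs no measurability of it.
    exact (Measure.le_map_apply (hXn n).aemeasurable
      {x | n * ε ≤ |Real.log (f n x) + densityEntropy (f n)|}).trans
      ((hν n).measure_abs_log_density_add_entropy_ge_le (hf n) hε hε1)
  filter_upwards [hconv] with ω hω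
  have hω' : Tendsto (fun n : ℕ => ((-((Real.log (f n (initialVector X n ω)) +
      densityEntropy (f n)) / n) : ℝ) : EReal)) atTop (𝓝 ((0 : ℝ) : EReal)) :=
    (continuous_coe_real_ereal.tendsto 0).comp (by simpa using hω.neg)
  -- Addition on `EReal` is continuous at `(h, 0)` even for `h = ±∞`, since the second entry is
  -- finite.
  have hsum := (EReal.continuousAt_add (p := (h, ((0 : ℝ) : EReal))) (Or.inr (by simp))
    (Or.inr (by simp))).tendsto.comp (hh.prodMk_nhds hω')
  simp only [EReal.coe_zero, add_zero] at hsum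
  refine hsum.congr fun n => ?_
  simp only [Function.comp_apply]
  rw [← EReal.coe_add]
  congr 1
  ring
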